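/- Let $G$ be a finite-dimensional complex Lie group with Lie algebra $\mathfrak g$, let $\mathfrak a\subset\mathfrak g$ be an Abelian Lie subalgebra, let $\{y_i\}$ be a basis of $\mathfrak a$ and $\{y^i\}$ the dual basis of $\mathfrak a^*$. Let $g:\mathfrak a^*\times\mathfrak a^*\to G$ be a function and let $\lambda\in\mathfrak a^*$ be such that $g$ is holomorphic near $(\lambda,\lambda)$ (for a meromorphic $g$ that is well defined at generic points of the diagonal, this holds for generic $\lambda$). Put $\gamma(\lambda)=g(\lambda,\lambda)$ and $$J(\lambda)=\,:g(\lambda,\lambda-\hbar(h^{(1)}+h^{(2)}))\,g(\lambda-\hbar h^{(2)},\lambda-\hbar(h^{(1)}+h^{(2)}))^{-1}\otimes g(\lambda,\lambda-\hbar(h^{(1)}+h^{(2)}))\,g(\lambda,\lambda-\hbar h^{(2)})^{-1}:\ \in (U(\mathfrak g)\otimes U(\mathfrak g))[[\hbar]].$$ Here the colons denote normal ordering: for $\mu,\nu\in\mathfrak a^*$ put in place of $h^{(1)},h^{(2)}$, the expression is expanded in a Taylor series in $\hbar\mu$ and $\hbar\nu$ with coefficients in $U(\mathfrak g)\otimes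 U(\mathfrak g)$ (both group-valued factors equal $1$ at $\hbar\mu=\hbar\nu=0$), and every monomial $\prod_i\mu_i^{\alpha_i}\prod_i\nu_i^{\beta_i}$ in the coordinates $\mu=\sum_i\mu_iy^i$, $\nu=\sum_i\nu_iy^i$ is then replaced by right multiplication by $\prod_i y_i^{\alpha_i}\otimes\prod_i y_i^{\beta_i}$. (If moreover $(\lambda-\mu)\circ\mathrm{Ad}_{g(\lambda,\mu)}=f(\lambda)-f(\mu)$ for some $f:\mathfrak a^*\to\mathfrak a^*$, then $J$ is the dynamical twist obtained from $1\otimes1$ by the quasi-grouplike vertex-IRF transformation defined by $g$; this condition is not needed below.) Then $J(\lambda)=1+\hbar\rho(\lambda)+O(\hbar^2)$ with $\rho(\lambda)\in\mathfrak g\otimes\mathfrak g$, and the quasi-classical limit $r(\lambda):=\rho(\lambda)-\rho^{21}(\lambda)$ of $J(\lambda)$ is $$r(\lambda)=\sum_i\frac{\partial\gamma(\lambda)}{\partial y^i}\,\gamma(\lambda)^{-1}\wedge y_i ,\qquad a\wedge b:=a\otimes b-b\otimes a .$$ -/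

import Mathlib

open scoped Manifold ContDiff TensorProduct

noncomputable section

namespace QuasiGrouplike

section Expansion

variable {σ : Type} [Fintype σ] [DecidableEq σ]

/-- The iterated partial derivative at `0` of a function of several complex variables, the list
giving the variables in which one differentiates. -/
def partialDerivs {V : Type*} [AddCommGroup V] [Module ℂ V] [TopologicalSpace V]
    (F : (σ → ℂ) → V) (l : List σ) : V :=
  (l.foldr (fun i D z => deriv (fun t : ℂ => D (z + t • Pi.single i 1)) 0) F) 0

/-- The Taylor coefficient `(1/α!) ∂^α F (0)` of a function of several complex variables. -/
def taylorCoeff {V : Type*} [AddCommGroup V] [Module ℂ V] [TopologicalSpace V]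
    (F : (σ → ℂ) → V) (α : σ →₀ ℕ) : V :=
  ((∏ i, (α i).factorial : ℕ) : ℂ)⁻¹ • partialDerivs F (Finsupp.toMultiset α).toList

/-- The right inverse of the Euler operator `∑ z_i ∂/∂z_i` on formal power series without
constant term: the coefficient of `z^α` is divided by `|α|`. -/
def eulerInv {R : Type*} [Ring R] [Algebra ℂ R] (S : MvPowerSeries σ R) : MvPowerSeries σ R :=
  fun α => ((α.degree : ℕ) : ℂ)⁻¹ • MvPowerSeries.coeff α S

/-- The terms of the iterated-integral (path-ordered exponential) solution of
`(∑ z_i ∂/∂z_i) S = A S`. -/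
def pathOrderedTerm {R : Type*} [Ring R] [Algebra ℂ R] (A : MvPowerSeries σ R) :
    ℕ → MvPowerSeries σ R
  | 0 => 1
  | m + 1 => eulerInv (A * pathOrderedTerm A m)

/-- If `A` has no constant term, this is the unique formal power series `S` with constant term `1`
and `(∑ z_i ∂/∂z_i) S = A S`. The `m`-th path-ordered term only has terms of degree at least `m`,
so that each coefficient is a finite sum. -/
def pathOrderedExp {R : Type*} [Ring R] [Algebra ℂ R] (A : MvPowerSeries σ R) :
    MvPowerSeries σ R :=
  fun α => ∑ m ∈ Finset.range (α.degree + 1), MvPowerSeries.coeff α (pathOrderedTerm A m)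

end Expansion

variable {E : Type*} [NormedAddCommGroup E] [NormedSpace ℂ E] [CompleteSpace E]
variable {G : Type*} [TopologicalSpace G] [ChartedSpace E G] [Group G] [LieGroup 𝓘(ℂ, E) ω G]

/-- The value at `t` of `(dc/dt) c⁻¹`, an element of the Lie algebra, for a curve `c` in `G`:
the derivative at `s = t` of `c s * (c t)⁻¹`, which passes through the identity at `s = t`. -/
def logDerivRight (c : ℂ → G) (t : ℂ) : GroupLieAlgebra 𝓘(ℂ, E) G :=
  (mfderiv 𝓘(ℂ, ℂ) 𝓘(ℂ, E) (fun s : ℂ => c s * (c t)⁻¹) t (1 : ℂ) : E)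

variable (E G) in
/-- The enveloping algebra of the Lie algebra of `G`. -/
abbrev U : Type _ := UniversalEnvelopingAlgebra ℂ (GroupLieAlgebra 𝓘(ℂ, E) G)

/-- The canonical map from the Lie algebra of `G` to its enveloping algebra, as a linear map. -/
def incl : GroupLieAlgebra 𝓘(ℂ, E) G →ₗ[ℂ] U E G where
  toFun x := UniversalEnvelopingAlgebra.ι ℂ x
  map_add' := map_add _
  map_smul' := map_smul _

section GroupExpansion

variable {σ : Type} [Fintype σ] [DecidableEq σ]

/-- The radial logarithmic derivative `∑ z_i (∂φ/∂z_i)(z) φ(z)⁻¹` of a `G`-valued function `φ`. -/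
def radialLogDeriv (φ : (σ → ℂ) → G) (z : σ → ℂ) : GroupLieAlgebra 𝓘(ℂ, E) G :=
  logDerivRight (E := E) (fun t : ℂ => φ (t • z)) 1

/-- The formal Taylor expansion at `0`, with coefficients in the enveloping algebra, of a
`G`-valued function `φ` holomorphic near `0` with `φ 0 = 1`. It is the solution with
constant term `1` of `∑ z_i ∂S/∂z_i = A S`, with `A` the Taylor series of the Lie algebra valued
function `∑ z_i (∂φ/∂z_i) φ⁻¹`. Thus for `φ = exp X`, where `X` has values in the Lie algebra, it is
`∑ Xⁿ/n!`, and in any representation of `G` it becomes the usual Taylor series of the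
operator-valued function given by `φ`. -/
def groupTaylor (φ : (σ → ℂ) → G) : MvPowerSeries σ (U E G) :=
  pathOrderedExp (fun α => incl (taylorCoeff (radialLogDeriv (E := E) φ) α))

end GroupExpansion

variable {𝔞 : LieSubalgebra ℂ (GroupLieAlgebra 𝓘(ℂ, E) G)} {n : ℕ}

/-- The point `∑ c_i yⁱ` of the dual of `𝔞`, where `(yⁱ)` is the basis dual to `(y_i)`. -/
def dualPoint (y : Module.Basis (Fin n) ℂ 𝔞) (c : Fin n → ℂ) : Module.Dual ℂ 𝔞 :=
  ∑ i, c i • y.coord i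

/-- `g` is holomorphic near the point `(l, l)` of the diagonal. -/
def HolomorphicAtDiag (y : Module.Basis (Fin n) ℂ 𝔞)
    (g : Module.Dual ℂ 𝔞 → Module.Dual ℂ 𝔞 → G) (l : Module.Dual ℂ 𝔞) : Prop :=
  ContMDiffAt 𝓘(ℂ, (Fin n → ℂ) × (Fin n → ℂ)) 𝓘(ℂ, E) ω
    (fun z : (Fin n → ℂ) × (Fin n → ℂ) => g (l + dualPoint y z.1) (l + dualPoint y z.2)) 0

/-- The ordered monomial `∏ y_i ^ α_i` in the enveloping algebra. (When `𝔞` is Abelian the order of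
the factors does not matter.) -/
def monomialU (y : Module.Basis (Fin n) ℂ 𝔞) (α : Fin n → ℕ) : U E G :=
  (List.ofFn fun i => incl ((y i : 𝔞) : GroupLieAlgebra 𝓘(ℂ, E) G) ^ α i).prod

/-- The point `∑ z_{1,i} yⁱ`, which stands for `ħ h⁽¹⁾`. -/
def hbarH1 (y : Module.Basis (Fin n) ℂ 𝔞) (z : Fin n ⊕ Fin n → ℂ) : Module.Dual ℂ 𝔞 :=
  dualPoint y fun i => z (Sum.inl i)

/-- The point `∑ z_{2,i} yⁱ`, which stands for `ħ h⁽²⁾`. -/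
def hbarH2 (y : Module.Basis (Fin n) ℂ 𝔞) (z : Fin n ⊕ Fin n → ℂ) : Module.Dual ℂ 𝔞 :=
  dualPoint y fun i => z (Sum.inr i)

/-- The group element in the first tensor factor of the twist, as a function of `ħ h⁽¹⁾`, `ħ h⁽²⁾`:
`g(l, l - ħ(h⁽¹⁾ + h⁽²⁾)) g(l - ħ h⁽²⁾, l - ħ(h⁽¹⁾ + h⁽²⁾))⁻¹`. -/
def twistFactor1 (y : Module.Basis (Fin n) ℂ 𝔞) (g : Module.Dual ℂ 𝔞 → Module.Dual ℂ 𝔞 → G)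
    (l : Module.Dual ℂ 𝔞) (z : Fin n ⊕ Fin n → ℂ) : G :=
  g l (l - (hbarH1 y z + hbarH2 y z)) *
    (g (l - hbarH2 y z) (l - (hbarH1 y z + hbarH2 y z)))⁻¹

/-- The group element in the second tensor factor of the twist, as a function of `ħ h⁽¹⁾`, `ħ h⁽²⁾`:
`g(l, l - ħ(h⁽¹⁾ + h⁽²⁾)) g(l, l - ħ h⁽²⁾)⁻¹`. -/
def twistFactor2 (y : Module.Basis (Fin n) ℂ 𝔞) (g : Module.Dual ℂ 𝔞 → Module.Dual ℂ 𝔞 → G)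
    (l : Module.Dual ℂ 𝔞) (z : Fin n ⊕ Fin n → ℂ) : G :=
  g l (l - (hbarH1 y z + hbarH2 y z)) * (g l (l - hbarH2 y z))⁻¹

/-- The expansion `K = ∑ K_{α,β} z₁^α z₂^β` of (first factor) `⊗` (second factor), with coefficients
in the tensor square of the enveloping algebra. -/
def twistSymbol (y : Module.Basis (Fin n) ℂ 𝔞) (g : Module.Dual ℂ 𝔞 → Module.Dual ℂ 𝔞 → G)
    (l : Module.Dual ℂ 𝔞) : MvPowerSeries (Fin n ⊕ Fin n) (U E G ⊗[ℂ] U E G) :=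
  MvPowerSeries.map (Algebra.TensorProduct.includeLeft :
      U E G →ₐ[ℂ] U E G ⊗[ℂ] U E G).toRingHom (groupTaylor (twistFactor1 y g l)) *
    MvPowerSeries.map (Algebra.TensorProduct.includeRight :
      U E G →ₐ[ℂ] U E G ⊗[ℂ] U E G).toRingHom (groupTaylor (twistFactor2 y g l))

/-- The twist
`J(l) = : g(l, l - ħ(h⁽¹⁾+h⁽²⁾)) g(l - ħh⁽²⁾, l - ħ(h⁽¹⁾+h⁽²⁾))⁻¹ ⊗`
`g(l, l - ħ(h⁽¹⁾+h⁽²⁾)) g(l, l - ħh⁽²⁾)⁻¹ :`,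
as a formal power series in `ħ`. Normal ordering puts `h⁽¹⁾`, `h⁽²⁾` to the extreme right: in the
expansion `∑ K_{α,β} z₁^α z₂^β`, the monomial `z₁^α z₂^β` is replaced by `ħ^(|α|+|β|)` times right
multiplication by `y^α ⊗ y^β`. -/
def twist (y : Module.Basis (Fin n) ℂ 𝔞) (g : Module.Dual ℂ 𝔞 → Module.Dual ℂ 𝔞 → G)
    (l : Module.Dual ℂ 𝔞) : PowerSeries (U E G ⊗[ℂ] U E G) :=
  PowerSeries.mk fun k =>
    ∑ α ∈ (Finset.univ : Finset (Fin n ⊕ Fin n)).finsuppAntidiag k,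
      MvPowerSeries.coeff α (twistSymbol y g l) *
        (monomialU y (fun i => α (Sum.inl i)) ⊗ₜ[ℂ] monomialU y (fun i => α (Sum.inr i)))

/-- The wedge `a ∧ b = a ⊗ b - b ⊗ a`. -/
def wedge (a b : GroupLieAlgebra 𝓘(ℂ, E) G) :
    GroupLieAlgebra 𝓘(ℂ, E) G ⊗[ℂ] GroupLieAlgebra 𝓘(ℂ, E) G :=
  a ⊗ₜ[ℂ] b - b ⊗ₜ[ℂ] a

/-- `(∂γ/∂v)(l) γ(l)⁻¹`, the logarithmic derivative of `γ` at `l` in the direction `v`. -/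
def dirLogDeriv (γ : Module.Dual ℂ 𝔞 → G) (l v : Module.Dual ℂ 𝔞) :
    GroupLieAlgebra 𝓘(ℂ, E) G :=
  logDerivRight (E := E) (fun t : ℂ => γ (l + t • v)) 0

end QuasiGrouplike

end

/-!
The coefficient of `ħ` in the twist is a sum over the `2n` coordinate directions of
`(ħ h⁽¹⁾, ħ h⁽²⁾)`: each direction contributes the first-order coefficient of the symbol, multiplied on
the right by `y_i ⊗ 1` or `1 ⊗ y_i` (`coeff_one_twist`).

The first-order coefficient of the formal Taylor expansion of a group-valued function `φ` in a
coordinate direction is the logarithmic derivative at `0` of the restriction of `φ` to the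
coordinate axis (`coeff_single_groupTaylor_eq_logDerivRight`). Indeed the radial logarithmic
derivative of `φ` at the point with coordinate `t` on the axis is `t L(t)`, where `L` is the
logarithmic derivative of the restriction, and `L` is continuous at `0`, so that `t L(t)` has
derivative `L(0)`.

Let `a_i` and `b_i` be the logarithmic derivatives of `g` at `(l, l)` in its first and in its
second argument, in the direction `yⁱ`. The sum and quotient rules `logDerivRight_diag` and
`logDerivRight_mul_inv` show that

* in the `i`-th direction of `ħ h⁽¹⁾` the first tensor factor is constant and the second one
  contributes `-b_i`;
* in the `i`-th direction of `ħ h⁽²⁾` the second tensor factor is constant and the first one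
  contributes `-b_i + (a_i + b_i) = a_i`.

Hence `ρ = ∑ (a_i ⊗ y_i - y_i ⊗ b_i)`. Antisymmetrization gives `∑ (a_i + b_i) ∧ y_i`, and `a_i + b_i` is
the logarithmic derivative of `γ(l) = g(l, l)`.
-/

namespace QuasiGrouplike

/-! ### Power series in degrees zero and one -/

section Expansion

variable {σ : Type}

lemma coeff_zero_pathOrderedExp {R : Type*} [Ring R] [Algebra ℂ R] (A : MvPowerSeries σ R) :
    MvPowerSeries.coeff 0 (pathOrderedExp A) = 1 := by
  change ∑ m ∈ Finset.range ((0 : σ →₀ ℕ).degree + 1),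
    MvPowerSeries.coeff 0 (pathOrderedTerm A m) = 1
  simp [pathOrderedTerm]

variable [DecidableEq σ]

/-- In degree one only the first path-ordered term `eulerInv A` contributes, and Euler's operator is
the identity there. -/
lemma coeff_single_pathOrderedExp {R : Type*} [Ring R] [Algebra ℂ R] (A : MvPowerSeries σ R)
    (j : σ) :
    MvPowerSeries.coeff (Finsupp.single j 1) (pathOrderedExp A) =
      MvPowerSeries.coeff (Finsupp.single j 1) A := by
  change ∑ m ∈ Finset.range ((Finsupp.single j 1 : σ →₀ ℕ).degree + 1),
    MvPowerSeries.coeff (Finsupp.single j 1) (pathOrderedTerm A m) = _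
  have h : MvPowerSeries.coeff (Finsupp.single j 1) (eulerInv (A * 1)) =
      (((Finsupp.single j 1 : σ →₀ ℕ).degree : ℕ) : ℂ)⁻¹ •
        MvPowerSeries.coeff (Finsupp.single j 1) (A * 1) := rfl
  rw [Finsupp.degree_single, Finset.sum_range_succ, Finset.sum_range_one]
  simp only [pathOrderedTerm]
  rw [h, Finsupp.degree_single, MvPowerSeries.coeff_one,
    if_neg (Finsupp.single_ne_zero.2 one_ne_zero)]
  simp

/-- Coefficient of a monomial of degree one in a product of two power series with constant
term `1`. -/
lemma coeff_single_mul {R : Type*} [Ring R] {S T : MvPowerSeries σ R}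
    (hS : MvPowerSeries.coeff 0 S = 1) (hT : MvPowerSeries.coeff 0 T = 1) (j : σ) :
    MvPowerSeries.coeff (Finsupp.single j 1) (S * T) =
      MvPowerSeries.coeff (Finsupp.single j 1) S + MvPowerSeries.coeff (Finsupp.single j 1) T := by
  rw [MvPowerSeries.coeff_mul, Finsupp.antidiagonal_single, Finset.sum_map,
    Finset.Nat.antidiagonal_succ]
  simp [hS, hT, add_comm]

variable [Fintype σ]

lemma taylorCoeff_single {V : Type*} [AddCommGroup V] [Module ℂ V] [TopologicalSpace V]
    (F : (σ → ℂ) → V) (j : σ) :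
    taylorCoeff F (Finsupp.single j 1) = deriv (fun t : ℂ => F (t • Pi.single j 1)) 0 := by
  have h : (∏ i, (Finsupp.single j 1 i).factorial : ℕ) = 1 :=
    Finset.prod_eq_one fun i _ => by
      rcases eq_or_ne j i with rfl | hij
      · simp
      · simp [Finsupp.single_eq_of_ne' hij]
  simp [taylorCoeff, h, partialDerivs]

lemma finsuppAntidiag_univ_one :
    (Finset.univ : Finset σ).finsuppAntidiag 1 =
      Finset.univ.map ⟨fun j => Finsupp.single j 1, Finsupp.single_left_injective one_ne_zero⟩ := by
  ext α
  simp only [Finset.mem_finsuppAntidiag, Finset.subset_univ, and_true, Finset.mem_map,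
    Finset.mem_univ, true_and, Function.Embedding.coeFn_mk]
  constructor
  · intro h
    obtain ⟨j, hj⟩ := (Finsupp.sum_eq_one_iff α).1
      ((Finsupp.sum_fintype α (fun _ => id) fun _ => rfl).trans h)
    exact ⟨j, hj.symm⟩
  · rintro ⟨j, rfl⟩
    simp [Finsupp.single_apply]

end Expansion

lemma prod_ofFn_pow_ite {R : Type*} [Monoid R] {n : ℕ} (f : Fin n → R) (j : Fin n) :
    (List.ofFn fun i => f i ^ (if i = j then 1 else 0)).prod = f j := by
  induction n with
  | zero => exact j.elim0
  | succ n ih =>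
    rw [List.ofFn_succ, List.prod_cons]
    refine Fin.cases ?_ (fun k => ?_) j
    · simp
    · simpa [Fin.succ_ne_zero, (Fin.succ_ne_zero _).symm] using ih (fun i => f i.succ) k

section LogDeriv

/-! ### Logarithmic derivatives of curves in a Lie group -/

variable {E : Type*} [NormedAddCommGroup E] [NormedSpace ℂ E]

/-- Chain rule along a curve `p` with velocity `w`. -/
lemma deriv_comp_curve {V : Type*} [NormedAddCommGroup V] [NormedSpace ℂ V] {Ψ : V → E} {v : V}
    (hΨ : DifferentiableAt ℂ Ψ v) {p : ℂ → V} {w : V} {t : ℂ} (hp : HasDerivAt p w t)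
    (hv : p t = v) : deriv (fun s => Ψ (p s)) t = fderiv ℂ Ψ v w := by
  subst hv
  exact (hΨ.hasFDerivAt.comp_hasDerivAt t hp).deriv

lemma hasDerivAt_smul_zero_of_continuousAt {L : ℂ → E} (hL : ContinuousAt L 0) :
    HasDerivAt (fun t : ℂ => t • L t) (L 0) 0 := by
  rw [hasDerivAt_iff_tendsto_slope]
  refine (hL.tendsto.mono_left nhdsWithin_le_nhds).congr' ?_
  filter_upwards [self_mem_nhdsWithin] with t ht
  have ht' : t ≠ 0 := ht
  simp only [slope, sub_zero, vsub_eq_sub, zero_smul]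
  rw [smul_smul, inv_mul_cancel₀ ht', one_smul]

variable {G : Type*} [TopologicalSpace G] [ChartedSpace E G]

lemma contMDiffAt_comp_contDiffAt {V W : Type*} [NormedAddCommGroup V] [NormedSpace ℂ V]
    [NormedAddCommGroup W] [NormedSpace ℂ W] {F : W → G} {p : V → W} {v : V} {w : W}
    (hF : ContMDiffAt 𝓘(ℂ, W) 𝓘(ℂ, E) ω F w) (hp : ContDiffAt ℂ ω p v) (hv : p v = w) :
    ContMDiffAt 𝓘(ℂ, V) 𝓘(ℂ, E) ω (fun u => F (p u)) v := by
  subst hv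
  exact hF.comp v hp.contMDiffAt

lemma contMDiffAt_comp_neg {c : ℂ → G} (hc : ContMDiffAt 𝓘(ℂ, ℂ) 𝓘(ℂ, E) ω c 0) :
    ContMDiffAt 𝓘(ℂ, ℂ) 𝓘(ℂ, E) ω (fun t => c (-t)) 0 :=
  contMDiffAt_comp_contDiffAt hc (by fun_prop) neg_zero

variable [Group G]

/-- The derivative of a curve at a point where it passes through `1`, read in the preferred chart
at `1`. -/
lemma mfderiv_eq_deriv_extChartAt_one {F : ℂ → G} {t : ℂ} (h1 : F t = 1)
    (hF : MDifferentiableAt 𝓘(ℂ, ℂ) 𝓘(ℂ, E) F t) :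
    (mfderiv 𝓘(ℂ, ℂ) 𝓘(ℂ, E) F t (1 : ℂ) : E) =
      deriv (fun s => extChartAt 𝓘(ℂ, E) (1 : G) (F s)) t := by
  rw [hF.mfderiv, ← h1]
  simp only [modelWithCornersSelf_coe, Set.range_id, fderivWithin_univ]
  rfl

lemma contDiffAt_extChartAt_one {V : Type*} [NormedAddCommGroup V] [NormedSpace ℂ V]
    [IsManifold 𝓘(ℂ, E) ω G] {F : V → G} {v : V} (h1 : F v = 1)
    (hF : ContMDiffAt 𝓘(ℂ, V) 𝓘(ℂ, E) ω F v) :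
    ContDiffAt ℂ ω (fun w => extChartAt 𝓘(ℂ, E) (1 : G) (F w)) v := by
  rw [← contMDiffAt_iff_contDiffAt]
  have h : ContMDiffAt 𝓘(ℂ, E) 𝓘(ℂ, E) ω (extChartAt 𝓘(ℂ, E) (1 : G)) (F v) := by
    rw [h1]; exact contMDiffAt_extChartAt
  exact h.comp v hF

lemma logDerivRight_const (x : G) (t : ℂ) : logDerivRight (E := E) (fun _ => x) t = 0 := by
  simp only [logDerivRight, mfderiv_const]
  rfl

lemma logDerivRight_mul_const (c : ℂ → G) (x : G) (t : ℂ) :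
    logDerivRight (E := E) (fun s => c s * x) t = logDerivRight (E := E) c t := by
  have h : (fun s => c s * x * (c t * x)⁻¹) = fun s => c s * (c t)⁻¹ := by
    funext s
    simp [mul_assoc]
  exact congrArg (fun F : ℂ → G => (mfderiv 𝓘(ℂ, ℂ) 𝓘(ℂ, E) F t (1 : ℂ) : E)) h

variable [LieGroup 𝓘(ℂ, E) ω G]

/-- The logarithmic derivative computed in the preferred chart at `1`, so that the curves
`s ↦ c s (c t)⁻¹` for all `t` are compared in one fixed chart. -/
lemma logDerivRight_eq_deriv {c : ℂ → G} {t : ℂ} (hc : ContMDiffAt 𝓘(ℂ, ℂ) 𝓘(ℂ, E) ω c t) :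
    logDerivRight (E := E) c t =
      deriv (fun s => extChartAt 𝓘(ℂ, E) (1 : G) (c s * (c t)⁻¹)) t :=
  mfderiv_eq_deriv_extChartAt_one (F := fun s => c s * (c t)⁻¹) (mul_inv_cancel _)
    ((hc.mul contMDiffAt_const).mdifferentiableAt (by simp))

lemma continuousAt_logDerivRight {c : ℂ → G} {t : ℂ}
    (hc : ContMDiffAt 𝓘(ℂ, ℂ) 𝓘(ℂ, E) ω c t) :
    ContinuousAt (fun s => (logDerivRight (E := E) c s : E)) t := by
  -- `logDerivRight c s` is the partial derivative of the jointly analytic function `Ψ` with respect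
  -- to its first variable, at the point `(s, s)`.
  let Ψ : ℂ × ℂ → E := fun p => extChartAt 𝓘(ℂ, E) (1 : G) (c p.1 * (c p.2)⁻¹)
  have hΨ : ∀ s, ContMDiffAt 𝓘(ℂ, ℂ) 𝓘(ℂ, E) ω c s → ContDiffAt ℂ ω Ψ (s, s) := fun s hs =>
    contDiffAt_extChartAt_one (F := fun p : ℂ × ℂ => c p.1 * (c p.2)⁻¹) (mul_inv_cancel _)
      ((contMDiffAt_comp_contDiffAt hs contDiffAt_fst rfl).mul
        (contMDiffAt_comp_contDiffAt hs contDiffAt_snd rfl).inv)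
  have hev : ∀ᶠ s in nhds t, ContMDiffAt 𝓘(ℂ, ℂ) 𝓘(ℂ, E) ω c s :=
    (contMDiffAt_iff_contMDiffAt_nhds (by simp)).1 hc
  have heq : ∀ᶠ s in nhds t,
      fderiv ℂ Ψ (s, s) (1, 0) = (logDerivRight (E := E) c s : E) := by
    filter_upwards [hev] with s hs
    rw [logDerivRight_eq_deriv hs]
    exact (deriv_comp_curve ((hΨ s hs).differentiableAt (by simp))
      ((hasDerivAt_id s).prodMk (hasDerivAt_const s s)) rfl).symm
  refine ContinuousAt.congr ?_ heq
  have h1 : ContinuousAt (fderiv ℂ Ψ) (t, t) :=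
    ((hΨ t hc).fderiv_right (m := 0) (by simp)).continuousAt
  have h2 : ContinuousAt (fun s : ℂ => (s, s)) t := by fun_prop
  exact (ContinuousAt.comp (f := fun s : ℂ => (s, s)) h1 h2).clm_apply continuousAt_const

lemma logDerivRight_comp_mul {c : ℂ → G} {t : ℂ} (hc : ContMDiffAt 𝓘(ℂ, ℂ) 𝓘(ℂ, E) ω c t) :
    (logDerivRight (E := E) (fun s => c (s * t)) 1 : E) =
      t • (logDerivRight (E := E) c t : E) := by
  have hc' : ContMDiffAt 𝓘(ℂ, ℂ) 𝓘(ℂ, E) ω (fun s => c (s * t)) 1 :=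
    contMDiffAt_comp_contDiffAt hc (by fun_prop) (one_mul t)
  rw [logDerivRight_eq_deriv hc, logDerivRight_eq_deriv hc']
  simp only [one_mul]
  have := deriv_comp_mul_left t (fun s => extChartAt 𝓘(ℂ, E) (1 : G) (c s * (c t)⁻¹)) 1
  simp only [mul_comm t, one_mul] at this
  exact this

/-- The radial logarithmic derivative at `t z` is `t` times the logarithmic derivative at `t` of the
restriction of `φ` to the line `ℂ z`. By continuity of the latter, its derivative at `t = 0` is the
logarithmic derivative at `0`. -/
lemma deriv_radialLogDeriv_smul {σ : Type} [Fintype σ] [DecidableEq σ] {φ : (σ → ℂ) → G}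
    {z : σ → ℂ} (hφ : ContMDiffAt 𝓘(ℂ, ℂ) 𝓘(ℂ, E) ω (fun t : ℂ => φ (t • z)) 0) :
    deriv (fun t : ℂ => radialLogDeriv (E := E) φ (t • z)) 0 =
      logDerivRight (E := E) (fun t : ℂ => φ (t • z)) 0 := by
  set c : ℂ → G := fun t => φ (t • z) with hcdef
  let L : ℂ → E := fun t => logDerivRight (E := E) c t
  let R : ℂ → E := fun t => radialLogDeriv (E := E) φ (t • z)
  have heq : R =ᶠ[nhds 0] fun t => t • L t := by
    filter_upwards [(contMDiffAt_iff_contMDiffAt_nhds (by simp)).1 hφ] with t ht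
    change _ = t • (logDerivRight (E := E) c t : E)
    rw [← logDerivRight_comp_mul ht]
    simp only [R, radialLogDeriv, smul_smul, hcdef]
  have hL : ContinuousAt L 0 := continuousAt_logDerivRight hφ
  have hd : HasDerivAt R (L 0) 0 :=
    (hasDerivAt_smul_zero_of_continuousAt hL).congr_of_eventuallyEq heq
  exact hd.deriv

lemma logDerivRight_comp_neg {c : ℂ → G} (hc : ContMDiffAt 𝓘(ℂ, ℂ) 𝓘(ℂ, E) ω c 0) :
    logDerivRight (E := E) (fun t => c (-t)) 0 = -logDerivRight (E := E) c 0 := by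
  have hc' : ContMDiffAt 𝓘(ℂ, ℂ) 𝓘(ℂ, E) ω (fun s => c (-s)) 0 :=
    contMDiffAt_comp_neg hc
  rw [logDerivRight_eq_deriv hc, logDerivRight_eq_deriv hc']
  have := deriv_comp_neg (fun s => extChartAt 𝓘(ℂ, E) (1 : G) (c s * (c 0)⁻¹)) 0
  simp only [neg_zero] at this ⊢
  exact this

/-- Additivity of the differential of a function of two variables, in logarithmic form. -/
lemma logDerivRight_diag {H : ℂ × ℂ → G}
    (hH : ContMDiffAt 𝓘(ℂ, ℂ × ℂ) 𝓘(ℂ, E) ω H 0) :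
    logDerivRight (E := E) (fun t => H (t, t)) 0 =
      logDerivRight (E := E) (fun t => H (t, 0)) 0 +
        logDerivRight (E := E) (fun t => H (0, t)) 0 := by
  have h1 : ContMDiffAt 𝓘(ℂ, ℂ) 𝓘(ℂ, E) ω (fun t => H (t, t)) 0 :=
    contMDiffAt_comp_contDiffAt hH (p := fun t => (t, t)) (by fun_prop) rfl
  have h2 : ContMDiffAt 𝓘(ℂ, ℂ) 𝓘(ℂ, E) ω (fun t => H (t, 0)) 0 :=
    contMDiffAt_comp_contDiffAt hH (p := fun t => (t, 0)) (by fun_prop) rfl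
  have h3 : ContMDiffAt 𝓘(ℂ, ℂ) 𝓘(ℂ, E) ω (fun t => H (0, t)) 0 :=
    contMDiffAt_comp_contDiffAt hH (p := fun t => (0, t)) (by fun_prop) rfl
  rw [logDerivRight_eq_deriv h1, logDerivRight_eq_deriv h2, logDerivRight_eq_deriv h3]
  have hΨ : DifferentiableAt ℂ
      (fun p => extChartAt 𝓘(ℂ, E) (1 : G) (H p * (H (0, 0))⁻¹)) ((0 : ℂ), (0 : ℂ)) :=
    (contDiffAt_extChartAt_one (F := fun p => H p * (H (0, 0))⁻¹) (mul_inv_cancel _)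
      (hH.mul contMDiffAt_const)).differentiableAt (by simp)
  have e1 := deriv_comp_curve hΨ ((hasDerivAt_id (0 : ℂ)).prodMk (hasDerivAt_id (0 : ℂ))) rfl
  have e2 := deriv_comp_curve hΨ ((hasDerivAt_id (0 : ℂ)).prodMk (hasDerivAt_const 0 (0 : ℂ))) rfl
  have e3 := deriv_comp_curve hΨ ((hasDerivAt_const 0 (0 : ℂ)).prodMk (hasDerivAt_id (0 : ℂ))) rfl
  refine e1.trans (Eq.trans ?_ (congrArg₂ (· + ·) e2 e3).symm)
  rw [← map_add]
  simp

/-- The derivative of `s ↦ c s (c t)⁻¹` and of `s ↦ c t (c s)⁻¹` add up to zero since `c s (c s)⁻¹`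
is constant; this gives the logarithmic derivative of a quotient of two curves through the
same point. -/
lemma logDerivRight_mul_inv {c d : ℂ → G} (hc : ContMDiffAt 𝓘(ℂ, ℂ) 𝓘(ℂ, E) ω c 0)
    (hd : ContMDiffAt 𝓘(ℂ, ℂ) 𝓘(ℂ, E) ω d 0) (h : c 0 = d 0) :
    logDerivRight (E := E) (fun t => c t * (d t)⁻¹) 0 =
      logDerivRight (E := E) c 0 - logDerivRight (E := E) d 0 := by
  -- The partial derivatives of `(u, v) ↦ b u (d v)⁻¹`. For `b = d` the left-hand side vanishes, which
  -- determines the second summand on the right.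
  have key : ∀ b : ℂ → G, ContMDiffAt 𝓘(ℂ, ℂ) 𝓘(ℂ, E) ω b 0 → b 0 = d 0 →
      logDerivRight (E := E) (fun t => b t * (d t)⁻¹) 0 = logDerivRight (E := E) b 0 +
        logDerivRight (E := E) (fun t => d 0 * (d t)⁻¹) 0 := fun b hb hbd => by
    have e := logDerivRight_diag (E := E) (H := fun p : ℂ × ℂ => b p.1 * (d p.2)⁻¹)
      ((contMDiffAt_comp_contDiffAt hb contDiffAt_fst rfl).mul
        (contMDiffAt_comp_contDiffAt hd contDiffAt_snd rfl).inv)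
    simpa only [logDerivRight_mul_const, hbd] using e
  have h0 := key d hd rfl
  simp only [mul_inv_cancel] at h0
  rw [logDerivRight_const] at h0
  rw [key c hc h, eq_neg_of_add_eq_zero_right h0.symm, sub_eq_add_neg]

end LogDeriv

variable {E : Type*} [NormedAddCommGroup E] [NormedSpace ℂ E] [CompleteSpace E]
variable {G : Type*} [TopologicalSpace G] [ChartedSpace E G] [Group G] [LieGroup 𝓘(ℂ, E) ω G]
variable {𝔞 : LieSubalgebra ℂ (GroupLieAlgebra 𝓘(ℂ, E) G)} {n : ℕ}

/-! ### The twist in degrees zero and one -/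

lemma monomialU_zero (y : Module.Basis (Fin n) ℂ 𝔞) : monomialU y (fun _ => 0) = 1 := by
  simp [monomialU]

lemma monomialU_ite (y : Module.Basis (Fin n) ℂ 𝔞) (j : Fin n) :
    monomialU y (fun i => if i = j then 1 else 0) =
      incl ((y j : 𝔞) : GroupLieAlgebra 𝓘(ℂ, E) G) :=
  prod_ofFn_pow_ite (fun i => incl ((y i : 𝔞) : GroupLieAlgebra 𝓘(ℂ, E) G)) j

lemma coeff_zero_groupTaylor {σ : Type} [Fintype σ] [DecidableEq σ] (φ : (σ → ℂ) → G) :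
    MvPowerSeries.coeff 0 (groupTaylor (E := E) φ) = 1 :=
  coeff_zero_pathOrderedExp _

lemma coeff_single_groupTaylor {σ : Type} [Fintype σ] [DecidableEq σ] (φ : (σ → ℂ) → G) (j : σ) :
    MvPowerSeries.coeff (Finsupp.single j 1) (groupTaylor (E := E) φ) =
      incl (deriv (fun t : ℂ => radialLogDeriv (E := E) φ (t • Pi.single j 1)) 0) := by
  rw [← taylorCoeff_single]
  exact coeff_single_pathOrderedExp _ j

lemma coeff_zero_twistSymbol (y : Module.Basis (Fin n) ℂ 𝔞)
    (g : Module.Dual ℂ 𝔞 → Module.Dual ℂ 𝔞 → G) (l : Module.Dual ℂ 𝔞) :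
    MvPowerSeries.coeff 0 (twistSymbol y g l) = 1 := by
  simp [twistSymbol, MvPowerSeries.coeff_mul, coeff_zero_groupTaylor, MvPowerSeries.coeff_map,
    Algebra.TensorProduct.one_def]

lemma coeff_single_twistSymbol (y : Module.Basis (Fin n) ℂ 𝔞)
    (g : Module.Dual ℂ 𝔞 → Module.Dual ℂ 𝔞 → G) (l : Module.Dual ℂ 𝔞) (j : Fin n ⊕ Fin n) :
    MvPowerSeries.coeff (Finsupp.single j 1) (twistSymbol y g l) =
      MvPowerSeries.coeff (Finsupp.single j 1) (groupTaylor (twistFactor1 y g l)) ⊗ₜ[ℂ] 1 +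
      1 ⊗ₜ[ℂ] MvPowerSeries.coeff (Finsupp.single j 1) (groupTaylor (twistFactor2 y g l)) := by
  rw [twistSymbol, coeff_single_mul] <;>
    simp only [MvPowerSeries.coeff_map, coeff_zero_groupTaylor, map_one]
  rfl

lemma coeff_zero_twist (y : Module.Basis (Fin n) ℂ 𝔞)
    (g : Module.Dual ℂ 𝔞 → Module.Dual ℂ 𝔞 → G) (l : Module.Dual ℂ 𝔞) :
    PowerSeries.coeff 0 (twist y g l) = 1 := by
  rw [twist, PowerSeries.coeff_mk, Finset.finsuppAntidiag_zero, Finset.sum_singleton,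
    coeff_zero_twistSymbol]
  simp only [Finsupp.coe_zero, Pi.zero_apply, monomialU_zero, one_mul]
  rfl

lemma coeff_one_twist (y : Module.Basis (Fin n) ℂ 𝔞)
    (g : Module.Dual ℂ 𝔞 → Module.Dual ℂ 𝔞 → G) (l : Module.Dual ℂ 𝔞) :
    PowerSeries.coeff 1 (twist y g l) =
      ∑ i, MvPowerSeries.coeff (Finsupp.single (Sum.inl i) 1) (twistSymbol y g l) *
          (incl ((y i : 𝔞) : GroupLieAlgebra 𝓘(ℂ, E) G) ⊗ₜ[ℂ] 1) +
      ∑ i, MvPowerSeries.coeff (Finsupp.single (Sum.inr i) 1) (twistSymbol y g l) *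
          (1 ⊗ₜ[ℂ] incl ((y i : 𝔞) : GroupLieAlgebra 𝓘(ℂ, E) G)) := by
  rw [twist, PowerSeries.coeff_mk, finsuppAntidiag_univ_one, Finset.sum_map,
    Fintype.sum_sum_type]
  simp [Finsupp.single_apply, monomialU_zero, ← monomialU_ite, eq_comm]

/-! ### First-order coefficients of the symbol as logarithmic derivatives -/

lemma coeff_single_groupTaylor_eq_logDerivRight {σ : Type} [Fintype σ] [DecidableEq σ]
    {φ : (σ → ℂ) → G} {j : σ} {c : ℂ → G} (hφ : ∀ t : ℂ, φ (t • Pi.single j 1) = c t)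
    (hc : ContMDiffAt 𝓘(ℂ, ℂ) 𝓘(ℂ, E) ω c 0) :
    MvPowerSeries.coeff (Finsupp.single j 1) (groupTaylor (E := E) φ) =
      incl (logDerivRight (E := E) c 0) := by
  obtain rfl : (fun t : ℂ => φ (t • Pi.single j 1)) = c := funext hφ
  rw [coeff_single_groupTaylor, deriv_radialLogDeriv_smul hc]

lemma dualPoint_smul_single (y : Module.Basis (Fin n) ℂ 𝔞) (t : ℂ) (i : Fin n) :
    dualPoint y (t • Pi.single i 1) = t • y.coord i := by
  simp [dualPoint, Pi.single_apply]

lemma hbarH1_smul_single_inl (y : Module.Basis (Fin n) ℂ 𝔞) (t : ℂ) (i : Fin n) :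
    hbarH1 y (t • Pi.single (Sum.inl i) 1) = t • y.coord i := by
  simp [hbarH1, dualPoint, Pi.single_apply]

lemma hbarH1_smul_single_inr (y : Module.Basis (Fin n) ℂ 𝔞) (t : ℂ) (i : Fin n) :
    hbarH1 y (t • Pi.single (Sum.inr i) 1) = 0 := by
  simp [hbarH1, dualPoint]

lemma hbarH2_smul_single_inl (y : Module.Basis (Fin n) ℂ 𝔞) (t : ℂ) (i : Fin n) :
    hbarH2 y (t • Pi.single (Sum.inl i) 1) = 0 := by
  simp [hbarH2, dualPoint]

lemma hbarH2_smul_single_inr (y : Module.Basis (Fin n) ℂ 𝔞) (t : ℂ) (i : Fin n) :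
    hbarH2 y (t • Pi.single (Sum.inr i) 1) = t • y.coord i := by
  simp [hbarH2, dualPoint, Pi.single_apply]

variable {y : Module.Basis (Fin n) ℂ 𝔞} {g : Module.Dual ℂ 𝔞 → Module.Dual ℂ 𝔞 → G}
  {l : Module.Dual ℂ 𝔞}

lemma HolomorphicAtDiag.contMDiffAt_plane (hg : HolomorphicAtDiag y g l) (i : Fin n) :
    ContMDiffAt 𝓘(ℂ, ℂ × ℂ) 𝓘(ℂ, E) ω
      (fun p : ℂ × ℂ => g (l + p.1 • y.coord i) (l + p.2 • y.coord i)) 0 := by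
  have h := contMDiffAt_comp_contDiffAt (v := (0 : ℂ × ℂ)) hg
    (p := fun p : ℂ × ℂ => (p.1 • (Pi.single i 1 : Fin n → ℂ), p.2 • (Pi.single i 1 : Fin n → ℂ)))
    (by fun_prop) (by simp)
  simpa only [dualPoint_smul_single] using h

lemma HolomorphicAtDiag.contMDiffAt_line_right (hg : HolomorphicAtDiag y g l) (i : Fin n) :
    ContMDiffAt 𝓘(ℂ, ℂ) 𝓘(ℂ, E) ω (fun t : ℂ => g l (l + t • y.coord i)) 0 := by
  simpa only [zero_smul, add_zero] using contMDiffAt_comp_contDiffAt (v := (0 : ℂ))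
    (hg.contMDiffAt_plane i) (p := fun t => (0, t)) (by fun_prop) rfl

lemma HolomorphicAtDiag.contMDiffAt_line_diag (hg : HolomorphicAtDiag y g l) (i : Fin n) :
    ContMDiffAt 𝓘(ℂ, ℂ) 𝓘(ℂ, E) ω (fun t : ℂ => g (l + t • y.coord i) (l + t • y.coord i)) 0 :=
  contMDiffAt_comp_contDiffAt (v := (0 : ℂ)) (hg.contMDiffAt_plane i) (p := fun t => (t, t))
    (by fun_prop) rfl

/-- The logarithmic derivative of `m ↦ g m m` is the sum of the two partial ones of `g`. -/
lemma HolomorphicAtDiag.dirLogDeriv_diag (hg : HolomorphicAtDiag y g l) (i : Fin n) :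
    dirLogDeriv (fun m => g m m) l (y.coord i) =
      dirLogDeriv (fun m => g m l) l (y.coord i) + dirLogDeriv (fun m => g l m) l (y.coord i) := by
  have h := logDerivRight_diag (E := E) (hg.contMDiffAt_plane i)
  simp only [zero_smul, add_zero] at h
  exact h

/-- In the `h⁽¹⁾` directions the first factor of the twist is constant, and the second one is
`g(l, l - t yⁱ) g(l, l)⁻¹`. -/
lemma coeff_inl_twistSymbol (hg : HolomorphicAtDiag y g l) (i : Fin n) :
    MvPowerSeries.coeff (Finsupp.single (Sum.inl i) 1) (twistSymbol y g l) =
      -((1 : U E G) ⊗ₜ[ℂ] incl (dirLogDeriv (fun m => g l m) l (y.coord i))) := by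
  have h2 := hg.contMDiffAt_line_right i
  have h2' : ContMDiffAt 𝓘(ℂ, ℂ) 𝓘(ℂ, E) ω (fun t : ℂ => g l (l + -t • y.coord i)) 0 :=
    contMDiffAt_comp_neg h2
  have e1 : MvPowerSeries.coeff (Finsupp.single (Sum.inl i) 1) (groupTaylor (twistFactor1 y g l)) =
      incl (logDerivRight (E := E) (fun _ : ℂ => (1 : G)) 0) :=
    coeff_single_groupTaylor_eq_logDerivRight (fun t => by
      simp only [twistFactor1, hbarH2_smul_single_inl, sub_zero, mul_inv_cancel]) contMDiffAt_const
  have e2 : MvPowerSeries.coeff (Finsupp.single (Sum.inl i) 1) (groupTaylor (twistFactor2 y g l)) =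
      incl (logDerivRight (E := E) (fun t : ℂ => g l (l + -t • y.coord i) * (g l l)⁻¹) 0) :=
    coeff_single_groupTaylor_eq_logDerivRight (fun t => by
      simp only [twistFactor2, hbarH2_smul_single_inl, hbarH1_smul_single_inl, add_zero,
        neg_smul, sub_eq_add_neg, neg_zero]) (h2'.mul contMDiffAt_const)
  rw [coeff_single_twistSymbol, e1, e2, logDerivRight_const,
    logDerivRight_mul_inv h2' contMDiffAt_const (by simp), logDerivRight_const, sub_zero,
    logDerivRight_comp_neg h2, map_zero, TensorProduct.zero_tmul, zero_add, map_neg,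
    TensorProduct.tmul_neg]
  rfl

/-- In the `h⁽²⁾` directions the second factor of the twist is constant, and the first one is
`g(l, l - t yⁱ) g(l - t yⁱ, l - t yⁱ)⁻¹`. The derivative of `g` in its second argument cancels and
that in the first argument remains. -/
lemma coeff_inr_twistSymbol (hg : HolomorphicAtDiag y g l) (i : Fin n) :
    MvPowerSeries.coeff (Finsupp.single (Sum.inr i) 1) (twistSymbol y g l) =
      incl (dirLogDeriv (fun m => g m l) l (y.coord i)) ⊗ₜ[ℂ] (1 : U E G) := by
  have h2 := hg.contMDiffAt_line_right i
  have h2' : ContMDiffAt 𝓘(ℂ, ℂ) 𝓘(ℂ, E) ω (fun t : ℂ => g l (l + -t • y.coord i)) 0 :=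
    contMDiffAt_comp_neg h2
  have h3 := hg.contMDiffAt_line_diag i
  have h3' : ContMDiffAt 𝓘(ℂ, ℂ) 𝓘(ℂ, E) ω
      (fun t : ℂ => g (l + -t • y.coord i) (l + -t • y.coord i)) 0 :=
    contMDiffAt_comp_neg h3
  have e1 : MvPowerSeries.coeff (Finsupp.single (Sum.inr i) 1) (groupTaylor (twistFactor1 y g l)) =
      incl (logDerivRight (E := E) (fun t : ℂ => g l (l + -t • y.coord i) *
        (g (l + -t • y.coord i) (l + -t • y.coord i))⁻¹) 0) :=
    coeff_single_groupTaylor_eq_logDerivRight (fun t => by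
      simp only [twistFactor1, hbarH2_smul_single_inr, hbarH1_smul_single_inr, zero_add,
        neg_smul, sub_eq_add_neg]) (h2'.mul h3'.inv)
  have e2 : MvPowerSeries.coeff (Finsupp.single (Sum.inr i) 1) (groupTaylor (twistFactor2 y g l)) =
      incl (logDerivRight (E := E) (fun _ : ℂ => (1 : G)) 0) :=
    coeff_single_groupTaylor_eq_logDerivRight (fun t => by
      simp only [twistFactor2, hbarH1_smul_single_inr, zero_add, mul_inv_cancel]) contMDiffAt_const
  rw [coeff_single_twistSymbol, e1, e2, logDerivRight_const,
    logDerivRight_mul_inv h2' h3' (by simp), logDerivRight_comp_neg h2, logDerivRight_comp_neg h3,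
    map_zero, TensorProduct.tmul_zero, add_zero, neg_sub_neg]
  exact congrArg (fun x => incl x ⊗ₜ[ℂ] (1 : U E G))
    (sub_eq_of_eq_add (hg.dirLogDeriv_diag i))

end QuasiGrouplike

open QuasiGrouplike in
theorem proposition3p6
    {E : Type*} [NormedAddCommGroup E] [NormedSpace ℂ E] [FiniteDimensional ℂ E] [CompleteSpace E]
    {G : Type*} [TopologicalSpace G] [ChartedSpace E G] [Group G] [LieGroup 𝓘(ℂ, E) ω G]
    (𝔞 : LieSubalgebra ℂ (GroupLieAlgebra 𝓘(ℂ, E) G)) [IsLieAbelian 𝔞]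
    {n : ℕ} (y : Module.Basis (Fin n) ℂ 𝔞)
    (g : Module.Dual ℂ 𝔞 → Module.Dual ℂ 𝔞 → G) (γ : Module.Dual ℂ 𝔞 → G)
    (hγ : ∀ l, γ l = g l l)
    (l : Module.Dual ℂ 𝔞) (hg : HolomorphicAtDiag y g l) :
    PowerSeries.coeff 0 (twist y g l) = 1 ∧
    ∃ ρ : GroupLieAlgebra 𝓘(ℂ, E) G ⊗[ℂ] GroupLieAlgebra 𝓘(ℂ, E) G,
      PowerSeries.coeff 1 (twist y g l) = TensorProduct.map incl incl ρ ∧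
      ρ - TensorProduct.comm ℂ _ _ ρ =
        ∑ i, wedge (dirLogDeriv γ l (y.coord i)) (y i : GroupLieAlgebra 𝓘(ℂ, E) G) := by
  refine ⟨coeff_zero_twist y g l,
    ∑ i, (dirLogDeriv (fun m => g m l) l (y.coord i) ⊗ₜ[ℂ] (y i : GroupLieAlgebra 𝓘(ℂ, E) G) -
      (y i : GroupLieAlgebra 𝓘(ℂ, E) G) ⊗ₜ[ℂ] dirLogDeriv (fun m => g l m) l (y.coord i)),
    ?_, ?_⟩
  · rw [coeff_one_twist, map_sum, ← Finset.sum_add_distrib]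
    refine Finset.sum_congr rfl fun i _ => ?_
    rw [coeff_inl_twistSymbol hg, coeff_inr_twistSymbol hg, map_sub, TensorProduct.map_tmul,
      TensorProduct.map_tmul, neg_mul, Algebra.TensorProduct.tmul_mul_tmul,
      Algebra.TensorProduct.tmul_mul_tmul, one_mul, mul_one, mul_one, neg_add_eq_sub]
  · rw [map_sum, ← Finset.sum_sub_distrib]
    refine Finset.sum_congr rfl fun i _ => ?_
    obtain rfl : γ = fun m => g m m := funext hγ
    rw [hg.dirLogDeriv_diag, wedge, map_sub, TensorProduct.comm_tmul, TensorProduct.comm_tmul,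
      TensorProduct.add_tmul, TensorProduct.tmul_add]
    abel
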